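/- Let $\{a_n\}_{n\ge 0}$ be a real sequence that is periodic with odd minimal period $p\ge 1$, and consider the difference equation $$x_{n+1}=x_{n-1}e^{a_n-x_{n-1}-x_n},\qquad n\ge 0, \tag{1}$$ with positive initial values $x_{-1},x_0$; the solution is the sequence $(x_n)_{n\ge -1}$. Put $s_n=\sum_{j=1}^{n}(-1)^j a_{j-1}$ and $\sigma=s_p$. Fix $t_0>0$, let $t_k=t_0^{(-1)^k}e^{(-1)^k s_k}$ and $g_k(x)=t_k x e^{-x}$ for $k\ge 0$, and set $$f=g_{2p-1}\circ\cdots\circ g_1\circ g_0,\qquad F=g_{p-1}\circ\cdots\circ g_1\circ g_0,$$ regarded as maps of $(0,\infty)$ into itself. A period is any positive period, unless it is called minimal. (a) If $s>0$ is a periodic point of $f$ with period $\omega$, then the solution of (1) with $x_{-1}=s$, $x_0=t_0se^{-s}$ has period $2p\omega$. If moreover $t_0\ne e^{-\sigma/2}$ and $\omega$ is the minimal period of $s$, then $2p\omega$ is its minimal period. (b) Let $t_0=e^{-\sigma/2}$. (Then $\{t_k\}$ has period $p$ and $f=F\circ F$.) If $s>0$ is a periodic point of $F$ with period $\omega$,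 then the solution of (1) with $x_{-1}=s$, $x_0=se^{-\sigma/2-s}$ has period $p\omega$; if $\omega$ is the minimal period of $s$ under $F$, then $p\omega$ is its minimal period. Moreover, the graph $\{(x,g_0(x)):x>0\}$ is invariant under the $p$-step map of (1) in the state plane: if $(x_{-1},x_0)$ lies on it, so does $(x_{pm-1},x_{pm})$ for every $m\ge 0$. (c) If $s>0$ is not a periodic point of $f$, then the solution of (1) with $x_{-1}=s$, $x_0=t_0se^{-s}$ is not periodic. In particular, if $f$ has a non-periodic point, then (1) has a non-periodic solution. (d) If $f$ has a point $s>0$ of minimal period three, then for every integer $n\ge 1$ equation (1) has a positive solution of minimal period $2pn$, and (1) has chaotic solutions in the sense of Li and Yorke: there is an uncountable set $S\subset(0,\infty)^2$ of initial values such that, writing $X_n=(x_{n-1},x_n)$ for the state and $\|\cdot\|$ for the maximum norm, - for any two solutions with different initial values in $S$, the states $X_n$, $X_n'$ satisfy $\limsup_{n\to\infty}\|X_n-X'_n\|>0$ and $\liminf_{n\to\infty}\|X_n-X'_n\|=0$; - for every solution with initial values in $S$ and every positive periodic solution of (1), with states $X_n$ and $Y_n$, $\limsup_{n\to\infty}\|X_n-Y_n\|>0$.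 The initial values of all these periodic and chaotic solutions can be taken on the curve $x_0=t_0x_{-1}e^{-x_{-1}}$. -/

import Mathlib

noncomputable section

namespace RickerEq

/-- `q` is the least positive period of the sequence `u`. -/
def HasMinimalPeriod (u : ℕ → ℝ) (q : ℕ) : Prop :=
  IsLeast {r : ℕ | 0 < r ∧ Function.Periodic u r} q

/-- The sequence `u` has some positive period. -/
def IsPeriodicSeq (u : ℕ → ℝ) : Prop :=
  ∃ r : ℕ, 0 < r ∧ Function.Periodic u r

/-- The solution of `x_{n+1} = x_{n-1} * exp (a_n - x_{n-1} - x_n)`, `n ≥ 0`, with initial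
values `x_{-1} = u` and `x_0 = v`.  Indices are shifted by one: `solution a u v n` is
`x_{n-1}`, so the sequence starts with `x_{-1}`. -/
def solution (a : ℕ → ℝ) (u v : ℝ) : ℕ → ℝ
  | 0 => u
  | 1 => v
  | n + 2 => solution a u v n * Real.exp (a n - solution a u v n - solution a u v (n + 1))

/-- The alternating sums `s_n = ∑_{j=1}^{n} (-1)^j a_{j-1}` (written with `j = i + 1`). -/
def altSum (a : ℕ → ℝ) (n : ℕ) : ℝ :=
  ∑ i ∈ Finset.range n, (-1 : ℝ) ^ (i + 1) * a i

/-- `t_n = t₀ ^ ((-1)^n) * exp ((-1)^n s_n)`; in particular `t_0 = t₀`. -/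
def tSeq (a : ℕ → ℝ) (t₀ : ℝ) (n : ℕ) : ℝ :=
  t₀ ^ ((-1 : ℤ) ^ n) * Real.exp ((-1 : ℝ) ^ n * altSum a n)

/-- `g_k(x) = t_k x e^{-x}`. -/
def gMap (a : ℕ → ℝ) (t₀ : ℝ) (k : ℕ) (x : ℝ) : ℝ :=
  tSeq a t₀ k * x * Real.exp (-x)

/-- `fMap a t₀ q` is the composition `g_{q-1} ∘ ⋯ ∘ g_1 ∘ g_0` of the first `q` maps. -/
def fMap (a : ℕ → ℝ) (t₀ : ℝ) : ℕ → ℝ → ℝ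
  | 0 => id
  | k + 1 => gMap a t₀ k ∘ fMap a t₀ k

/-- The point `(x_{n-1}, x_n)` of the state plane on the solution with
`(x_{-1}, x_0) = z`. -/
def state (a : ℕ → ℝ) (z : ℝ × ℝ) (n : ℕ) : ℝ × ℝ :=
  (solution a z.1 z.2 n, solution a z.1 z.2 (n + 1))

/-- Li–Yorke chaos on a set `S` of positive initial values `(x_{-1}, x_0)`: `S` is uncountable,
any two different solutions starting in `S` come arbitrarily close infinitely often but do not
approach each other, and no solution starting in `S` approaches a positive periodic solution.
The upper and lower limits are taken in `[0, ∞]`. -/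
structure IsLiYorkeChaoticSet (a : ℕ → ℝ) (S : Set (ℝ × ℝ)) : Prop where
  pos : ∀ z ∈ S, 0 < z.1 ∧ 0 < z.2
  uncountable : ¬ S.Countable
  limsup_pos : ∀ z ∈ S, ∀ w ∈ S, z ≠ w →
    0 < Filter.limsup (fun n => edist (state a z n) (state a w n)) Filter.atTop
  liminf_zero : ∀ z ∈ S, ∀ w ∈ S, z ≠ w →
    Filter.liminf (fun n => edist (state a z n) (state a w n)) Filter.atTop = 0
  limsup_periodic_pos : ∀ z ∈ S, ∀ w : ℝ × ℝ, 0 < w.1 → 0 < w.2 →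
    IsPeriodicSeq (solution a w.1 w.2) →
    0 < Filter.limsup (fun n => edist (state a z n) (state a w n)) Filter.atTop

end RickerEq

end

open RickerEq

open Set Function Filter Topology

/-! Along a positive solution put `t_n = x_n / (x_{n-1} e^{-x_{n-1}})`. The equation says exactly
that `t_{n+1} t_n = e^{a_n}`, so `t` depends only on `t₀` and `a`, and the solution is the orbit of
`s = x_{-1}` under the maps `g_0, g_1, ...` (`tSeq_succ_mul`, `solution_eq_fMap`). As `p` is odd,
`t` has period `2p`, and it has period `p` exactly when `t₀² = e^{-σ}`. Sampling every `2p` (or `p`)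
steps gives the orbit of `s` under `f` (or `F`). Conversely `t` can be read off from the solution,
so every period of the solution is a period of `t`; this settles the minimal periods
(`hasMinimalPeriod_fMap`) and (c).

For (d), with `t₀² ≠ e^{-σ}`, an `n`-cycle of `f` gives minimal period `2pn`, and "period three
implies all periods" applies. If `t₀² = e^{-σ}`, then `f = F ∘ F` and a cycle of `F` of length `2n`
is needed. A cycle of `F ∘ F` of length `n` has length `2n` or, for odd `n`, possibly `n` under `F`;
the second case is repaired by the part of Sharkovskii's theorem giving all lengths `m ≥ 2n - 4`
from an odd length `n ≥ 3` (`exists_minimalPeriod_eq_of_odd`), and `n = 1` by passing from length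
four to length two.

Chaos comes from two disjoint intervals each of which `f^[4]` maps over both. Itineraries through
them, coded by binary sequences, give the scrambled set, which is carried to the state plane along
the graph of `g_0`. -/

namespace IntervalDynamics

/-! ### Covering relations between compact intervals. -/

theorem exists_Icc_image_eq_of_le {f : ℝ → ℝ} (hf : Continuous f) {x y c d : ℝ} (hxy : x ≤ y)
    (hcd : c ≤ d) (hx : f x = c) (hy : f y = d) :
    ∃ a b, x ≤ a ∧ a ≤ b ∧ b ≤ y ∧ f '' Icc a b = Icc c d := by
  -- Take `a` as the last point with value `c`, and `b` as the first point after `a` with value `d`;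
  -- by the intermediate value theorem no value between them leaves `[c, d]`.
  obtain ⟨a, ⟨⟨hxa, hay⟩, hfa⟩, hamax⟩ := IsCompact.exists_isGreatest
    (s := Icc x y ∩ f ⁻¹' {c}) (isCompact_Icc.inter_right (isClosed_singleton.preimage hf))
    ⟨x, ⟨le_refl x, hxy⟩, hx⟩
  obtain ⟨b, ⟨⟨hab, hby⟩, hfb⟩, hbmin⟩ := IsCompact.exists_isLeast
    (s := Icc a y ∩ f ⁻¹' {d}) (isCompact_Icc.inter_right (isClosed_singleton.preimage hf))
    ⟨y, ⟨hay, le_refl y⟩, hy⟩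
  simp only [mem_preimage, mem_singleton_iff] at hfa hfb
  refine ⟨a, b, hxa, hab, hby, Subset.antisymm ?_ ?_⟩
  · rintro _ ⟨z, ⟨hza, hzb⟩, rfl⟩
    constructor
    · by_contra! hlt
      obtain ⟨w, ⟨hzw, hwb⟩, hw⟩ := intermediate_value_Icc hzb hf.continuousOn
        (show c ∈ Icc (f z) (f b) from ⟨hlt.le, hfb ▸ hcd⟩)
      have hwa : w ≤ a := hamax ⟨⟨by linarith, by linarith⟩, hw⟩
      have : z = a := by linarith
      rw [this, hfa] at hlt
      exact lt_irrefl _ hlt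
    · by_contra! hlt
      obtain ⟨w, ⟨haw, hwz⟩, hw⟩ := intermediate_value_Icc hza hf.continuousOn
        (show d ∈ Icc (f a) (f z) from ⟨hfa ▸ hcd, hlt.le⟩)
      have hwb : b ≤ w := hbmin ⟨⟨by linarith, by linarith⟩, hw⟩
      have : z = b := by linarith
      rw [this, hfb] at hlt
      exact lt_irrefl _ hlt
  · have := intermediate_value_Icc hab hf.continuousOn
    rwa [hfa, hfb] at this

/-- An interval covered by the image of an interval is the exact image of a subinterval. -/
theorem exists_Icc_image_eq {f : ℝ → ℝ} (hf : Continuous f) {a b c d : ℝ} (hcd : c ≤ d)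
    (h : Icc c d ⊆ f '' Icc a b) :
    ∃ a' b', a' ≤ b' ∧ Icc a' b' ⊆ Icc a b ∧ f '' Icc a' b' = Icc c d := by
  obtain ⟨x, hx, hfx⟩ := h (left_mem_Icc.2 hcd)
  obtain ⟨y, hy, hfy⟩ := h (right_mem_Icc.2 hcd)
  rcases le_total x y with hxy | hyx
  · obtain ⟨a', b', h1, h2, h3, h4⟩ := exists_Icc_image_eq_of_le hf hxy hcd hfx hfy
    exact ⟨a', b', h2, Icc_subset_Icc (hx.1.trans h1) (h3.trans hy.2), h4⟩
  · obtain ⟨a', b', h1, h2, h3, h4⟩ := exists_Icc_image_eq_of_le (f := fun z => -f z)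
      hf.neg hyx (neg_le_neg hcd) (by simp [hfy]) (by simp [hfx])
    refine ⟨a', b', h2, Icc_subset_Icc (hy.1.trans h1) (h3.trans hx.2), ?_⟩
    have h5 := congrArg (fun s => (fun z : ℝ => -z) '' s) h4
    simpa [image_image] using h5

/-- A finite chain of covering intervals is followed by all points of a subinterval of the first
one, which is mapped exactly onto the last one. -/
theorem exists_Icc_itinerary {f : ℝ → ℝ} (hf : Continuous f) {l r : ℕ → ℝ} (m : ℕ)
    (hlr : ∀ i ≤ m, l i ≤ r i)
    (hcov : ∀ i < m, Icc (l (i + 1)) (r (i + 1)) ⊆ f '' Icc (l i) (r i)) :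
    ∃ a b, a ≤ b ∧ (∀ x ∈ Icc a b, ∀ i ≤ m, f^[i] x ∈ Icc (l i) (r i)) ∧
      f^[m] '' Icc a b = Icc (l m) (r m) := by
  induction m with
  | zero =>
    refine ⟨l 0, r 0, hlr 0 le_rfl, ?_, by simp⟩
    intro x hx i hi
    obtain rfl : i = 0 := by omega
    exact hx
  | succ m ih =>
    obtain ⟨a, b, hab, hit, him⟩ := ih (fun i hi => hlr i (by omega))
      (fun i hi => hcov i (by omega))
    obtain ⟨a', b', hab', hsub, him'⟩ := exists_Icc_image_eq (hf.iterate (m + 1))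
      (a := a) (b := b) (hlr (m + 1) le_rfl) (by
        rw [iterate_succ', image_comp, him]
        exact hcov m (by omega))
    refine ⟨a', b', hab', ?_, him'⟩
    intro x hx i hi
    rcases Nat.lt_or_ge m i with h | h
    · obtain rfl : i = m + 1 := by omega
      exact him' ▸ mem_image_of_mem _ hx
    · exact hit x (hsub hx) i h

/-- A closed chain of covering intervals is followed by a periodic point. -/
theorem exists_isPeriodicPt_itinerary {f : ℝ → ℝ} (hf : Continuous f) {l r : ℕ → ℝ} (m : ℕ)
    (hlr : ∀ i ≤ m, l i ≤ r i)
    (hcov : ∀ i < m, Icc (l (i + 1)) (r (i + 1)) ⊆ f '' Icc (l i) (r i))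
    (hl : l m = l 0) (hr : r m = r 0) :
    ∃ x, IsPeriodicPt f m x ∧ ∀ i ≤ m, f^[i] x ∈ Icc (l i) (r i) := by
  obtain ⟨a, b, hab, hit, him⟩ := exists_Icc_itinerary hf m hlr hcov
  have hle := hlr m le_rfl
  obtain ⟨x, hx, hfx⟩ := him.symm ▸ left_mem_Icc.2 hle
  obtain ⟨y, hy, hfy⟩ := him.symm ▸ right_mem_Icc.2 hle
  have hx0 := hit x hx 0 (Nat.zero_le _)
  have hy0 := hit y hy 0 (Nat.zero_le _)
  simp only [iterate_zero, id] at hx0 hy0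
  have hsub : uIcc x y ⊆ Icc a b := OrdConnected.uIcc_subset inferInstance hx hy
  -- The image `[l m, r m] = [l 0, r 0]` contains `[a, b]`, so `f^[m] - id` changes sign between
  -- preimages of the two ends.
  have hmem : (0 : ℝ) ∈ uIcc (f^[m] x - x) (f^[m] y - y) := by
    rw [mem_uIcc]
    left
    rw [hfx, hfy, hl, hr]
    exact ⟨by linarith [hx0.1], by linarith [hy0.2]⟩
  obtain ⟨z, hz, hfz⟩ := intermediate_value_uIcc
    ((hf.iterate m).sub continuous_id).continuousOn hmem
  exact ⟨z, sub_eq_zero.1 hfz, hit z (hsub hz)⟩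

/-! ### From a four-cycle to a two-cycle. -/

/-- Two intervals with at most a non-fixed point in common that cover each other contain a
cycle of length two. -/
theorem exists_minimalPeriod_eq_two_of_covers {f : ℝ → ℝ} (hf : Continuous f) {a b c d : ℝ}
    (hab : a ≤ b) (hbc : b ≤ c) (hcd : c ≤ d) (hb : f b ≠ b)
    (h1 : Icc c d ⊆ f '' Icc a b) (h2 : Icc a b ⊆ f '' Icc c d) :
    ∃ x ∈ Icc a b, minimalPeriod f x = 2 := by
  obtain ⟨x, hx, hit⟩ := exists_isPeriodicPt_itinerary hf
    (l := fun i => if i = 1 then c else a) (r := fun i => if i = 1 then d else b) 2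
    (by intro i _; split_ifs <;> assumption)
    (by
      intro i hi
      interval_cases i
      · simpa using h1
      · simpa using h2) (by simp) (by simp)
  have hx0 := hit 0 (by norm_num)
  have hx1 := hit 1 (by norm_num)
  simp only [iterate_zero, id, iterate_one, if_true, zero_ne_one, if_false] at hx0 hx1
  refine ⟨x, hx0, minimalPeriod_eq_prime hx fun hfix => hb ?_⟩
  have hfx : f x = x := hfix
  rw [hfx] at hx1
  have : x = b := le_antisymm hx0.2 (hbc.trans hx1.1)
  rwa [this] at hfx

theorem Icc_subset_image_of_mem_Icc {f : ℝ → ℝ} (hf : Continuous f) {a b x y c d : ℝ}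
    (hx : x ∈ Icc a b) (hy : y ∈ Icc a b) (hc : f x ≤ c) (hd : d ≤ f y) :
    Icc c d ⊆ f '' Icc a b := by
  refine Subset.trans ?_ (image_mono (OrdConnected.uIcc_subset inferInstance hx hy))
  refine Subset.trans ?_ (intermediate_value_uIcc hf.continuousOn)
  exact (Icc_subset_Icc hc hd).trans Icc_subset_uIcc

/-- A continuous map with a cycle of length four has a cycle of length two. -/
theorem exists_minimalPeriod_eq_two_of_four {f : ℝ → ℝ} (hf : Continuous f) {s : ℝ}
    (hs : minimalPeriod f s = 4) {U : Set ℝ} (hU : U.OrdConnected) (hsU : ∀ k, f^[k] s ∈ U) :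
    ∃ x ∈ U, minimalPeriod f x = 2 := by
  obtain ⟨k, -, hk⟩ := Finset.exists_min_image (Finset.range 4) (fun k => f^[k] s) ⟨0, by simp⟩
  have hper : s ∈ periodicPts f := minimalPeriod_pos_iff_mem_periodicPts.1 (by omega)
  obtain ⟨q, hq⟩ : ∃ q, q = f^[k] s := ⟨_, rfl⟩
  have hq4 : minimalPeriod f q = 4 := by rw [hq, minimalPeriod_apply_iterate hper, hs]
  have hqU : ∀ j, f^[j] q ∈ U := fun j => by
    rw [hq, ← iterate_add_apply]; exact hsU _
  have hmin : ∀ j, q ≤ f^[j] q := fun j => by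
    rw [hq, ← iterate_add_apply, ← iterate_mod_minimalPeriod_eq (n := j + k), hs]
    exact hk _ (Finset.mem_range.2 (Nat.mod_lt _ (by norm_num)))
  have hinj : ∀ i < 4, ∀ j < 4, i ≠ j → f^[i] q ≠ f^[j] q := fun i hi j hj hij h => by
    have := (iterate_eq_iterate_iff_of_lt_minimalPeriod (hq4 ▸ hi) (hq4 ▸ hj)).1 h
    exact hij this
  have h4 : f (f^[3] q) = q := by
    rw [← iterate_succ_apply' f 3 q]
    have := iterate_minimalPeriod (f := f) (x := q)
    rwa [hq4] at this
  obtain ⟨p1, hp1⟩ : ∃ p, p = f^[1] q := ⟨_, rfl⟩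
  obtain ⟨p2, hp2⟩ : ∃ p, p = f^[2] q := ⟨_, rfl⟩
  obtain ⟨p3, hp3⟩ : ∃ p, p = f^[3] q := ⟨_, rfl⟩
  have f0 : f q = p1 := hp1.symm
  have f1 : f p1 = p2 := by rw [hp1, hp2]; rfl
  have f2 : f p2 = p3 := by rw [hp2, hp3]; rfl
  have f3 : f p3 = q := by rw [hp3]; exact h4
  have l1 : q < p1 := lt_of_le_of_ne (hp1 ▸ hmin 1) (hp1 ▸ hinj 0 (by omega) 1 (by omega) (by omega))
  have l2 : q < p2 := lt_of_le_of_ne (hp2 ▸ hmin 2) (hp2 ▸ hinj 0 (by omega) 2 (by omega) (by omega))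
  have l3 : q < p3 := lt_of_le_of_ne (hp3 ▸ hmin 3) (hp3 ▸ hinj 0 (by omega) 3 (by omega) (by omega))
  have n12 : p1 ≠ p2 := hp1 ▸ hp2 ▸ hinj 1 (by omega) 2 (by omega) (by omega)
  have n13 : p1 ≠ p3 := hp1 ▸ hp3 ▸ hinj 1 (by omega) 3 (by omega) (by omega)
  have n23 : p2 ≠ p3 := hp2 ▸ hp3 ▸ hinj 2 (by omega) 3 (by omega) (by omega)
  have m0 : q ∈ U := hqU 0
  have m1 : p1 ∈ U := hp1 ▸ hqU 1
  have m2 : p2 ∈ U := hp2 ▸ hqU 2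
  have m3 : p3 ∈ U := hp3 ▸ hqU 3
  -- It suffices to find intervals `[a, b]` and `[c, d]` that cover each other; `x₁, y₁` and `x₂,
  -- y₂` are points whose images witness the coverings. Since `q` is the least point of the cycle,
  -- only six orders of the other three remain, and cycle points serve in each.
  have key : ∀ a b c d x₁ y₁ x₂ y₂ : ℝ, a ∈ U → b ∈ U → a ≤ b → b ≤ c → c ≤ d → f b ≠ b →
      x₁ ∈ Icc a b → y₁ ∈ Icc a b → f x₁ ≤ c → d ≤ f y₁ →
      x₂ ∈ Icc c d → y₂ ∈ Icc c d → f x₂ ≤ a → b ≤ f y₂ → ∃ x ∈ U, minimalPeriod f x = 2 := by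
    intro a b c d x₁ y₁ x₂ y₂ haU hbU hab hbc hcd hb hx₁ hy₁ h1 h2 hx₂ hy₂ h3 h4
    obtain ⟨x, hx, hx2⟩ := exists_minimalPeriod_eq_two_of_covers hf hab hbc hcd hb
      (Icc_subset_image_of_mem_Icc hf hx₁ hy₁ h1 h2) (Icc_subset_image_of_mem_Icc hf hx₂ hy₂ h3 h4)
    exact ⟨x, hU.out haU hbU hx, hx2⟩
  rcases lt_or_gt_of_ne n12 with h12 | h12 <;> rcases lt_or_gt_of_ne n13 with h13 | h13 <;>
    rcases lt_or_gt_of_ne n23 with h23 | h23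
  · apply key p1 p2 p2 p3 p1 p2 p3 p2 <;> grind
  · apply key q p1 p3 p2 q p1 p3 p2 <;> grind
  · linarith
  · apply key q p3 p3 p1 p3 q p3 p1 <;> grind
  · apply key q p2 p1 p3 q p2 p3 p1 <;> grind
  · linarith
  · apply key q p2 p3 p1 p2 q p3 p1 <;> grind
  · apply key q p3 p3 p2 p3 q p3 p2 <;> grind

/-! ### Cycles forced by a cycle of odd length. -/

/-- The hulls of the iterated images of two neighbouring points `u < v` of a cycle `P` of length
at most `n` that are mapped across each other exhaust the cycle after `n - 2` steps. -/
theorem exists_Icc_growing {f : ℝ → ℝ} (hf : Continuous f) {P : Finset ℝ} {n : ℕ}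
    (hPcard : P.card ≤ n) (hn : 2 ≤ n) (hPf : ∀ x ∈ P, f x ∈ P)
    (hPorbit : ∀ Q : Finset ℝ, Q.Nonempty → Q ⊆ P → (∀ x ∈ Q, f x ∈ Q) → Q = P)
    {u v : ℝ} (huP : u ∈ P) (hvP : v ∈ P) (huv : u < v) (hfu : v ≤ f u) (hfv : f v ≤ u) :
    ∃ l r : ℕ → ℝ, l 0 = u ∧ r 0 = v ∧ (∀ i, l i ≤ r i) ∧
      (∀ i, Icc (l (i + 1)) (r (i + 1)) ⊆ f '' Icc (l i) (r i)) ∧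
      ∀ x ∈ P, x ∈ Icc (l (n - 2)) (r (n - 2)) := by
  -- `Q (i + 1)` is the set of cycle points in the hull of `f (Q i)`.
  obtain ⟨Q, hQ0, hQs⟩ : ∃ Q : ℕ → Finset ℝ, Q 0 = {u, v} ∧ ∀ i, Q (i + 1) =
      P.filter (fun z => ∃ x ∈ Q i, ∃ y ∈ Q i, f x ≤ z ∧ z ≤ f y) :=
    ⟨fun i => Nat.rec {u, v}
      (fun _ q => P.filter (fun z => ∃ x ∈ q, ∃ y ∈ q, f x ≤ z ∧ z ≤ f y)) i, rfl, fun _ => rfl⟩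
  have hQP : ∀ i, Q i ⊆ P := fun i => by
    cases i with
    | zero => rw [hQ0]; intro x hx; simp only [Finset.mem_insert, Finset.mem_singleton] at hx
              rcases hx with rfl | rfl <;> assumption
    | succ i => rw [hQs]; exact Finset.filter_subset _ _
  have hQmono : ∀ i, Q i ⊆ Q (i + 1) := fun i => by
    induction i with
    | zero =>
      intro x hx
      rw [hQs, Finset.mem_filter]
      refine ⟨hQP 0 hx, v, by simp [hQ0], u, by simp [hQ0], ?_⟩
      rw [hQ0] at hx
      simp only [Finset.mem_insert, Finset.mem_singleton] at hx
      rcases hx with rfl | rfl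
      · exact ⟨hfv, (huv.le.trans hfu)⟩
      · exact ⟨hfv.trans huv.le, hfu⟩
    | succ i ih =>
      intro x hx
      rw [hQs, Finset.mem_filter] at hx ⊢
      obtain ⟨hxP, y, hy, z, hz, h⟩ := hx
      exact ⟨hxP, y, ih hy, z, ih hz, h⟩
  have hQne : ∀ i, (Q i).Nonempty := fun i => by
    induction i with
    | zero => exact ⟨u, by simp [hQ0]⟩
    | succ i ih => exact ih.mono (hQmono i)
  -- Each step gains a point until the sets stabilize; a stable set is invariant, hence the whole
  -- cycle.
  have hQcard : ∀ i, Q i = P ∨ i + 2 ≤ (Q i).card := fun i => by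
    induction i with
    | zero => right; rw [hQ0, Finset.card_pair huv.ne]
    | succ i ih =>
      rcases ih with h | h
      · exact Or.inl (Finset.Subset.antisymm (hQP _) (h ▸ hQmono i))
      · rcases (hQmono i).eq_or_ssubset with he | hss
        · left
          rw [← he]
          refine hPorbit _ (hQne i) (hQP i) fun x hx => ?_
          rw [he, hQs, Finset.mem_filter]
          exact ⟨hPf x (hQP i hx), x, hx, x, hx, le_rfl, le_rfl⟩
        · right
          have := Finset.card_lt_card hss
          omega
  have hQn : Q (n - 2) = P := by
    rcases hQcard (n - 2) with h | h
    · exact h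
    · exact Finset.eq_of_subset_of_card_le (hQP _) (by omega)
  choose l hlQ hlmin using fun i => Finset.exists_min_image (Q i) id (hQne i)
  choose r hrQ hrmax using fun i => Finset.exists_max_image (Q i) id (hQne i)
  simp only [id] at hlmin hrmax
  have hlr : ∀ i, l i ≤ r i := fun i => hlmin i _ (hrQ i)
  have hl0 : l 0 = u := by
    refine le_antisymm (hlmin 0 u (by simp [hQ0])) ?_
    have := hlQ 0
    rw [hQ0] at this
    simp only [Finset.mem_insert, Finset.mem_singleton] at this
    rcases this with h | h <;> rw [h]
    exact huv.le
  have hr0 : r 0 = v := by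
    refine le_antisymm ?_ (hrmax 0 v (by simp [hQ0]))
    have := hrQ 0
    rw [hQ0] at this
    simp only [Finset.mem_insert, Finset.mem_singleton] at this
    rcases this with h | h <;> rw [h]
    exact huv.le
  have hgrow : ∀ i, Icc (l (i + 1)) (r (i + 1)) ⊆ f '' Icc (l i) (r i) := fun i => by
    have h1 := hlQ (i + 1)
    have h2 := hrQ (i + 1)
    rw [hQs, Finset.mem_filter] at h1 h2
    obtain ⟨-, x, hx, -, -, hxl, -⟩ := h1
    obtain ⟨-, -, -, y, hy, -, hyr⟩ := h2
    exact Icc_subset_image_of_mem_Icc hf ⟨hlmin i x hx, hrmax i x hx⟩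
      ⟨hlmin i y hy, hrmax i y hy⟩ hxl hyr
  exact ⟨l, r, hl0, hr0, hlr, hgrow, fun x hx => ⟨hlmin _ x (hQn ▸ hx), hrmax _ x (hQn ▸ hx)⟩⟩

/-- Given a cycle `P` of length `n`, neighbouring points `u < v` of it, a chain of covering
intervals from `[u, v]` to the hull of `P`, and an interval `[c, d]` on one side of `(u, v)` that
covers `[u, v]`, there are cycles of all lengths `m ≥ 2 n - 4`. -/
theorem exists_minimalPeriod_eq_of_loop {f : ℝ → ℝ} (hf : Continuous f) {P : Finset ℝ} {n m : ℕ}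
    (hn : 3 ≤ n) (hm : 2 * n - 4 ≤ m) (hPf : ∀ x ∈ P, f x ∈ P)
    (hPper : ∀ x ∈ P, minimalPeriod f x = n) {u v c d : ℝ} {l r : ℕ → ℝ}
    (huP : u ∈ P) (hvP : v ∈ P) (hmeet : ∀ x ∈ P, x ∈ Icc u v → x = u ∨ x = v)
    (hl0 : l 0 = u) (hr0 : r 0 = v) (hlr : ∀ i, l i ≤ r i)
    (hgrow : ∀ i, Icc (l (i + 1)) (r (i + 1)) ⊆ f '' Icc (l i) (r i))
    (hself : Icc (l 0) (r 0) ⊆ f '' Icc (l 0) (r 0))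
    (hcd : c ≤ d) (hlast : Icc c d ⊆ Icc (l (n - 2)) (r (n - 2)))
    (hcov : Icc u v ⊆ f '' Icc c d) (hone : d = u ∨ c = v) :
    ∃ x ∈ Icc u v, minimalPeriod f x = m := by
  -- The loop stays in `[u, v]` at times `0, ..., m + 1 - n` (the truncated subtraction gives index
  -- `0`), then grows, is in `[c, d]` at time `m - 1`, and returns at time `m`.
  obtain ⟨x, hxm, hit⟩ := exists_isPeriodicPt_itinerary hf
    (l := fun i => if i = m then l 0 else if i = m - 1 then c else l (i - (m + 1 - n)))
    (r := fun i => if i = m then r 0 else if i = m - 1 then d else r (i - (m + 1 - n))) m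
    (by
      intro i _
      split_ifs
      · exact hlr 0
      · exact hcd
      · exact hlr _)
    (by
      intro i hi
      rw [if_neg hi.ne, if_neg hi.ne]
      by_cases h1 : i = m - 1
      · have h0 : i + 1 = m := by omega
        rw [if_pos h1, if_pos h1, if_pos h0, if_pos h0, hl0, hr0]
        exact hcov
      · have h0 : ¬ i + 1 = m := by omega
        rw [if_neg h1, if_neg h1, if_neg h0, if_neg h0]
        by_cases h2 : i + 1 = m - 1
        · rw [if_pos h2, if_pos h2]
          refine hlast.trans ?_
          rw [show n - 2 = i - (m + 1 - n) + 1 by omega]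
          exact hgrow _
        · rw [if_neg h2, if_neg h2]
          by_cases h3 : i + 1 ≤ m + 1 - n
          · rw [Nat.sub_eq_zero_of_le h3, Nat.sub_eq_zero_of_le (by omega : i ≤ m + 1 - n)]
            exact hself
          · rw [show i + 1 - (m + 1 - n) = i - (m + 1 - n) + 1 by omega]
            exact hgrow _)
    (by rw [if_pos rfl, if_neg (by omega), if_neg (by omega), Nat.zero_sub])
    (by rw [if_pos rfl, if_neg (by omega), if_neg (by omega), Nat.zero_sub])
  have hstay : ∀ i, i < m - 1 → i ≤ m + 1 - n → f^[i] x ∈ Icc u v := fun i h1 h2 => by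
    have := hit i (by omega)
    rwa [if_neg (by omega), if_neg (by omega), if_neg (by omega), if_neg (by omega),
      Nat.sub_eq_zero_of_le h2, hl0, hr0] at this
  have hxcd : f^[m - 1] x ∈ Icc c d := by
    have := hit (m - 1) (by omega)
    rwa [if_neg (by omega), if_pos rfl, if_neg (by omega), if_pos rfl] at this
  refine ⟨x, hstay 0 (by omega) (by omega), ?_⟩
  by_contra hne
  obtain ⟨e, he⟩ := hxm.minimalPeriod_dvd
  have hpos : 0 < minimalPeriod f x := hxm.minimalPeriod_pos (by omega)
  have hxper : x ∈ periodicPts f := minimalPeriod_pos_iff_mem_periodicPts.1 hpos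
  have he2 : 2 ≤ e := by
    by_contra! h
    interval_cases e
    · omega
    · omega
  have hle : 2 * minimalPeriod f x ≤ m := by nlinarith
  -- A proper divisor of `m` is at most `m / 2`, and `m / 2 - 1 ≤ m + 1 - n` is the bound `m ≥ 2 n -
  -- 4`. So this point still lies in `[u, v]`, as well as in `[c, d]`: it is `u` or `v`, and `x`
  -- lies on `P`.
  have hback : f^[m - 1] x = f^[minimalPeriod f x - 1] x := by
    obtain ⟨e, rfl⟩ : ∃ e', e = e' + 1 := ⟨e - 1, by omega⟩
    rw [show m - 1 = minimalPeriod f x - 1 + minimalPeriod f x * e by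
      rw [mul_add, mul_one] at he; omega, iterate_add_apply,
      ((isPeriodicPt_minimalPeriod f x).mul_const e).eq]
  have hxuv : f^[m - 1] x ∈ Icc u v := hback ▸ hstay _ (by omega) (by omega)
  have hxP : f^[m - 1] x ∈ P := by
    rcases hone with rfl | rfl
    · rwa [le_antisymm hxcd.2 hxuv.1]
    · rwa [le_antisymm hxuv.2 hxcd.1]
  have hdn : minimalPeriod f x = n := by
    rw [← hPper _ hxP, minimalPeriod_apply_iterate hxper]
  have hx0 : x ∈ P := by
    have := hPf _ hxP
    rwa [← iterate_succ_apply' f, Nat.succ_eq_add_one, Nat.sub_add_cancel (by omega), hxm.eq] at this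
  -- Now the period is `n` and `2 n ≤ m`, so three distinct cycle points would all lie in `[u, v]`,
  -- which has only two.
  have hpair : ∀ i < 3, f^[i] x = u ∨ f^[i] x = v := fun i hi => by
    refine hmeet _ ?_ (hstay i (by omega) (by omega))
    clear hi
    induction i with
    | zero => exact hx0
    | succ i ih => rw [iterate_succ_apply']; exact hPf _ ih
  have hinj : ∀ i < 3, ∀ j < 3, i ≠ j → f^[i] x ≠ f^[j] x := fun i hi j hj hij h =>
    hij ((iterate_eq_iterate_iff_of_lt_minimalPeriod (by omega) (by omega)).1 h)
  have h01 := hinj 0 (by omega) 1 (by omega) (by omega)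
  have h02 := hinj 0 (by omega) 2 (by omega) (by omega)
  have h12 := hinj 1 (by omega) 2 (by omega) (by omega)
  rcases hpair 0 (by omega) with h0 | h0 <;> rcases hpair 1 (by omega) with h1 | h1 <;>
    rcases hpair 2 (by omega) with h2 | h2 <;>
    first
    | exact h01 (h0.trans h1.symm)
    | exact h02 (h0.trans h2.symm)
    | exact h12 (h1.trans h2.symm)

/-- A continuous map with a cycle of odd length `n ≥ 3` has cycles of all lengths
`m ≥ 2 n - 4`. -/
theorem exists_minimalPeriod_eq_of_odd {f : ℝ → ℝ} (hf : Continuous f) {s : ℝ} {n : ℕ}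
    (hs : minimalPeriod f s = n) (hodd : Odd n) (hn : 3 ≤ n) {m : ℕ} (hm : 2 * n - 4 ≤ m)
    {U : Set ℝ} (hU : U.OrdConnected) (hsU : ∀ k, f^[k] s ∈ U) :
    ∃ x ∈ U, minimalPeriod f x = m := by
  have hsper : s ∈ periodicPts f := minimalPeriod_pos_iff_mem_periodicPts.1 (by omega)
  obtain ⟨P, hP⟩ : ∃ P : Finset ℝ, P = (Finset.range n).image (fun k => f^[k] s) := ⟨_, rfl⟩
  have hPcard : P.card ≤ n := by
    rw [hP]; exact Finset.card_image_le.trans (by simp)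
  have hPiter : ∀ k, f^[k] s ∈ P := fun k => by
    rw [← iterate_mod_minimalPeriod_eq (n := k), hs, hP]
    exact Finset.mem_image.2 ⟨k % n, Finset.mem_range.2 (Nat.mod_lt _ (by omega)), rfl⟩
  have hPex : ∀ x ∈ P, ∃ k < n, x = f^[k] s := fun x hx => by
    rw [hP] at hx
    obtain ⟨k, hk, rfl⟩ := Finset.mem_image.1 hx
    exact ⟨k, Finset.mem_range.1 hk, rfl⟩
  have hPU : ∀ x ∈ P, x ∈ U := fun x hx => by
    obtain ⟨k, -, rfl⟩ := hPex x hx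
    exact hsU k
  have hPf : ∀ x ∈ P, f x ∈ P := fun x hx => by
    obtain ⟨k, -, rfl⟩ := hPex x hx
    rw [← iterate_succ_apply' f]
    exact hPiter _
  have hPper : ∀ x ∈ P, minimalPeriod f x = n := fun x hx => by
    obtain ⟨k, -, rfl⟩ := hPex x hx
    rw [minimalPeriod_apply_iterate hsper, hs]
  have hPne : ∀ x ∈ P, f x ≠ x := fun x hx h => by
    have := minimalPeriod_eq_one_iff_isFixedPt.2 h
    have := hPper x hx
    omega
  have hPorbit : ∀ Q : Finset ℝ, Q.Nonempty → Q ⊆ P → (∀ x ∈ Q, f x ∈ Q) → Q = P := by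
    intro Q ⟨x, hx⟩ hQP hQ
    refine Finset.Subset.antisymm hQP fun y hy => ?_
    obtain ⟨k, hk, rfl⟩ := hPex x (hQP hx)
    obtain ⟨j, hj, rfl⟩ := hPex y hy
    have hit : ∀ i, f^[i] (f^[k] s) ∈ Q := fun i => by
      induction i with
      | zero => exact hx
      | succ i ih => rw [iterate_succ_apply']; exact hQ _ ih
    have h1 := hit (j + (n - k))
    rw [← iterate_add_apply, show j + (n - k) + k = j + n by omega, iterate_add_apply, ← hs,
      iterate_minimalPeriod] at h1
    exact h1
  -- the two neighbours `u < v` in the cycle between which the map crosses the diagonal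
  obtain ⟨u, hu, humax⟩ : ∃ u ∈ P.filter (fun x => x < f x),
      ∀ x ∈ P.filter (fun x => x < f x), x ≤ u := by
    refine Finset.exists_max_image _ id ?_
    obtain ⟨x, hx, hxmin⟩ := Finset.exists_min_image P id ⟨s, hPiter 0⟩
    exact ⟨x, Finset.mem_filter.2 ⟨hx, lt_of_le_of_ne (hxmin _ (hPf x hx)) (hPne x hx).symm⟩⟩
  obtain ⟨huP, huf⟩ := Finset.mem_filter.1 hu
  obtain ⟨v, hv, hvmin⟩ : ∃ v ∈ P.filter (fun x => u < x), ∀ x ∈ P.filter (fun x => u < x), v ≤ x :=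
    Finset.exists_min_image _ id ⟨f u, Finset.mem_filter.2 ⟨hPf u huP, huf⟩⟩
  obtain ⟨hvP, huv⟩ := Finset.mem_filter.1 hv
  have hside : ∀ x ∈ P, x ≤ u ∨ v ≤ x := fun x hx => by
    rcases le_or_gt x u with h | h
    · exact Or.inl h
    · exact Or.inr (hvmin x (Finset.mem_filter.2 ⟨hx, h⟩))
  have hfu : v ≤ f u := hvmin _ (Finset.mem_filter.2 ⟨hPf u huP, huf⟩)
  have hfv : f v ≤ u := by
    rcases hside _ (hPf v hvP) with h | h
    · exact h
    · exact absurd (humax v (Finset.mem_filter.2 ⟨hvP, lt_of_le_of_ne h (hPne v hvP).symm⟩))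
        (not_le.2 huv)
  have hmeet : ∀ x ∈ P, x ∈ Icc u v → x = u ∨ x = v := fun x hx hxI =>
    (hside x hx).imp (fun h => le_antisymm h hxI.1) (fun h => le_antisymm hxI.2 h)
  -- an interval on one side of `(u, v)` that covers `[u, v]`
  obtain ⟨c, d, hcP, hdP, hcd, hcov, hone⟩ : ∃ c d, c ∈ P ∧ d ∈ P ∧ c ≤ d ∧
      Icc u v ⊆ f '' Icc c d ∧ (d = u ∨ c = v) := by
    -- Otherwise `f` exchanges the cycle points on the two sides of the gap `(u, v)`, which is
    -- impossible for an odd cycle: an odd iterate of `u` would lie on the right, yet `f^[n] u = u`.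
    by_contra! hno
    have hL : ∀ x ∈ P, x ≤ u → v ≤ f x := fun x hx hxu => by
      by_contra hlt
      have hfx := (hside _ (hPf x hx)).resolve_right hlt
      exact (hno x u hx huP hxu (Icc_subset_image_of_mem_Icc hf (left_mem_Icc.2 hxu)
        (right_mem_Icc.2 hxu) hfx hfu)).1 rfl
    have hR : ∀ x ∈ P, v ≤ x → f x ≤ u := fun x hx hxv => by
      by_contra hlt
      have hfx := (hside _ (hPf x hx)).resolve_left hlt
      exact (hno v x hvP hx hxv (Icc_subset_image_of_mem_Icc hf (left_mem_Icc.2 hxv)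
        (right_mem_Icc.2 hxv) hfv hfx)).2 rfl
    have hit : ∀ k, f^[2 * k] u ∈ P ∧ f^[2 * k] u ≤ u := fun k => by
      induction k with
      | zero => exact ⟨huP, le_rfl⟩
      | succ k ih =>
        rw [show 2 * (k + 1) = 2 * k + 1 + 1 by ring, iterate_succ_apply', iterate_succ_apply']
        exact ⟨hPf _ (hPf _ ih.1), hR _ (hPf _ ih.1) (hL _ ih.1 ih.2)⟩
    obtain ⟨k, hk⟩ := hodd
    have h1 := hL _ (hit k).1 (hit k).2
    rw [← iterate_succ_apply' f, Nat.succ_eq_add_one, ← hk, ← hPper u huP, iterate_minimalPeriod] at h1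
    exact absurd h1 (not_le.2 huv)
  obtain ⟨l, r, hl0, hr0, hlr, hgrow, hlast⟩ :=
    exists_Icc_growing hf hPcard (by omega) hPf hPorbit huP hvP huv hfu hfv
  obtain ⟨x, hx, hxm⟩ := exists_minimalPeriod_eq_of_loop hf hn hm hPf hPper huP hvP hmeet hl0 hr0
    hlr hgrow (by
      rw [hl0, hr0]
      exact Icc_subset_image_of_mem_Icc hf (right_mem_Icc.2 huv.le) (left_mem_Icc.2 huv.le) hfv hfu)
    hcd (Icc_subset_Icc (hlast c hcP).1 (hlast d hdP).2) hcov hone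
  exact ⟨x, hU.out (hPU u huP) (hPU v hvP) hx, hxm⟩

/-! ### Horseshoes and scrambled sets. -/

/-- The fourth iterate of a continuous map with a three-cycle has a horseshoe consisting of two
disjoint intervals. -/
theorem exists_horseshoe_of_three_cycle {f : ℝ → ℝ} (hf : Continuous f) {a b c : ℝ}
    (hab : f a = b) (hbc : f b = c) (hca : f c = a) (hne : a ≠ b) (hb : b ∈ uIcc a c) :
    ∃ l₀ r₀ l₁ r₁ : ℝ, l₀ ≤ r₀ ∧ l₁ ≤ r₁ ∧ Disjoint (Icc l₀ r₀) (Icc l₁ r₁) ∧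
      Icc l₀ r₀ ⊆ uIcc a c ∧ Icc l₁ r₁ ⊆ uIcc a c ∧
      uIcc a c ⊆ f^[4] '' Icc l₀ r₀ ∧ uIcc a c ⊆ f^[4] '' Icc l₁ r₁ := by
  have hK : uIcc b c ⊆ f '' uIcc a b := by
    have := intermediate_value_uIcc (hf.continuousOn (s := uIcc a b))
    rwa [hab, hbc] at this
  have hL : uIcc a c ⊆ f '' uIcc b c := by
    have := intermediate_value_uIcc (hf.continuousOn (s := uIcc b c))
    rwa [hbc, hca, uIcc_comm] at this
  have hKH : uIcc a b ⊆ uIcc a c := uIcc_subset_uIcc_left hb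
  have hLH : uIcc b c ⊆ uIcc a c := uIcc_subset_uIcc_right hb
  have himage : ∀ {s t u : Set ℝ}, t ⊆ f '' s → u ⊆ f '' t → u ⊆ f^[2] '' s := by
    intro s t u h1 h2
    rw [iterate_succ, iterate_one, image_comp]
    exact h2.trans (image_mono h1)
  have h2K : uIcc a c ⊆ f^[2] '' uIcc a b := himage hK hL
  have h2L : uIcc a c ⊆ f^[2] '' uIcc b c := himage (hLH.trans hL) hL
  have h4 : ∀ s : Set ℝ, f^[4] '' s = f^[2] '' (f^[2] '' s) := fun s => by
    rw [← image_comp, ← iterate_add]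
  -- The hulls of `a, b` and of `b, c` both cover everything under `f^[2]` but share `b`. Shrinking
  -- the second to a piece mapped by `f^[2]` exactly onto it removes `b`, because `f^[2] b = a` lies
  -- outside; the price is two more iterates.
  obtain ⟨l₁, r₁, hlr, hsub, him⟩ := exists_Icc_image_eq (hf.iterate 2) (a := b ⊓ c) (b := b ⊔ c)
    (c := b ⊓ c) (d := b ⊔ c) inf_le_sup (hLH.trans h2L)
  refine ⟨a ⊓ b, a ⊔ b, l₁, r₁, inf_le_sup, hlr, ?_, hKH, hsub.trans hLH, ?_, ?_⟩
  · rw [Set.disjoint_left]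
    intro x hx hx1
    have hxb : x = b := by
      have hxL : x ∈ uIcc b c := hsub hx1
      have hxK : x ∈ uIcc a b := hx
      rw [mem_uIcc] at hxL hxK hb
      grind
    have haL : a ∈ uIcc b c := by
      have := mem_image_of_mem (f^[2]) hx1
      rw [him, hxb] at this
      rwa [show f^[2] b = a by rw [iterate_succ_apply, iterate_one, hbc, hca]] at this
    rw [mem_uIcc] at haL hb
    grind
  · rw [h4]
    exact h2K.trans (image_mono (hKH.trans h2K))
  · rw [h4, him]
    exact h2L

/-- Itineraries through a sequence of compact sets, with prescribed times of visit. -/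
theorem exists_itinerary_of_isCompact {g : ℝ → ℝ} (hg : Continuous g) {C : ℕ → Set ℝ} {M : ℕ → ℕ}
    (hM : M 0 = 0) (hmono : Monotone M) (hC : ∀ j, IsCompact (C j)) (hne : ∀ j, (C j).Nonempty)
    (hcov : ∀ j, C (j + 1) ⊆ g^[M (j + 1) - M j] '' C j) : ∃ x, ∀ j, g^[M j] x ∈ C j := by
  have hback : ∀ j, ∀ y ∈ C j, ∃ x, g^[M j] x = y ∧ ∀ i ≤ j, g^[M i] x ∈ C i := by
    intro j
    induction j with
    | zero =>
      intro y hy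
      refine ⟨y, by rw [hM]; rfl, fun i hi => ?_⟩
      obtain rfl : i = 0 := by omega
      rwa [hM]
    | succ j ih =>
      intro y hy
      obtain ⟨z, hz, hzy⟩ := hcov j hy
      obtain ⟨x, hx, hxi⟩ := ih z hz
      have hxy : g^[M (j + 1)] x = y := by
        rw [← Nat.sub_add_cancel (hmono (Nat.le_succ j)), iterate_add_apply, hx]
        exact hzy
      refine ⟨x, hxy, fun i hi => ?_⟩
      rcases Nat.lt_or_ge j i with h | h
      · obtain rfl : i = j + 1 := by omega
        rwa [hxy]
      · exact hxi i h
  have hclosed : ∀ j, IsClosed {x | ∀ i ≤ j, g^[M i] x ∈ C i} := fun j => by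
    simp only [ofPred_forall]
    exact isClosed_iInter fun i => isClosed_iInter fun _ =>
      (hC i).isClosed.preimage (hg.iterate _)
  obtain ⟨x, hx⟩ := IsCompact.nonempty_iInter_of_sequence_nonempty_isCompact_isClosed
    (fun j => {x | ∀ i ≤ j, g^[M i] x ∈ C i}) (fun j x hx i hi => hx i (by omega))
    (fun j => by
      obtain ⟨y, hy⟩ := hne j
      obtain ⟨x, -, hx⟩ := hback j y hy
      exact ⟨x, hx⟩)
    ((hC 0).of_isClosed_subset (hclosed 0) fun x hx => by
      have := hx 0 le_rfl
      rwa [hM] at this) hclosed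
  exact ⟨x, fun j => mem_iInter.1 hx j j le_rfl⟩

/-- The lengths of pairwise disjoint subintervals of a compact interval tend to zero. -/
theorem tendsto_length_of_pairwise_disjoint {a b : ℕ → ℝ} {l r : ℝ}
    (hsub : ∀ n, Icc (a n) (b n) ⊆ Icc l r)
    (hdisj : Pairwise (Disjoint on fun n => Icc (a n) (b n))) (hab : ∀ n, a n ≤ b n) :
    Tendsto (fun n => b n - a n) atTop (𝓝 0) := by
  have hsum : ∑' n, MeasureTheory.volume (Icc (a n) (b n)) ≠ ⊤ := by
    rw [← MeasureTheory.measure_iUnion hdisj fun _ => measurableSet_Icc]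
    exact ne_top_of_le_ne_top (by simp) (MeasureTheory.measure_mono (iUnion_subset hsub))
  have h := ENNReal.tendsto_atTop_zero_of_tsum_ne_top hsum
  have h2 := (ENNReal.tendsto_toReal ENNReal.zero_ne_top).comp h
  refine h2.congr fun n => ?_
  simp [Real.volume_Icc, ENNReal.toReal_ofReal (sub_nonneg.2 (hab n))]

/-- In a horseshoe there are arbitrarily long stays in the first interval, followed by a visit to
the second one, on arbitrarily short intervals. -/
theorem exists_short_Icc_of_horseshoe {g : ℝ → ℝ} (hg : Continuous g) {l₀ r₀ l₁ r₁ : ℝ}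
    (h₀ : l₀ ≤ r₀) (h₁ : l₁ ≤ r₁) (hdisj : Disjoint (Icc l₀ r₀) (Icc l₁ r₁))
    (hc₀ : Icc l₀ r₀ ∪ Icc l₁ r₁ ⊆ g '' Icc l₀ r₀) {ε : ℝ} (hε : 0 < ε) (N : ℕ) :
    ∃ n, N < n ∧ ∃ a b, b - a < ε ∧ Icc a b ⊆ Icc l₀ r₀ ∧
      (∀ x ∈ Icc a b, ∀ i < n, g^[i] x ∈ Icc l₀ r₀) ∧ g^[n] '' Icc a b = Icc l₁ r₁ := by
  have hT : ∀ n : ℕ, ∃ a b, a ≤ b ∧ (∀ x ∈ Icc a b, ∀ i < n + 1, g^[i] x ∈ Icc l₀ r₀) ∧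
      g^[n + 1] '' Icc a b = Icc l₁ r₁ := by
    intro n
    obtain ⟨a, b, hab, hit, him⟩ := exists_Icc_itinerary hg
      (l := fun i => if i < n + 1 then l₀ else l₁) (r := fun i => if i < n + 1 then r₀ else r₁)
      (n + 1) (by intro i _; split_ifs <;> assumption)
      (by
        intro i hi
        rw [if_pos hi, if_pos hi]
        split_ifs
        · exact subset_union_left.trans hc₀
        · exact subset_union_right.trans hc₀)
    rw [if_neg (lt_irrefl _), if_neg (lt_irrefl _)] at him
    refine ⟨a, b, hab, fun x hx i hi => ?_, him⟩
    have := hit x hx i hi.le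
    rwa [if_pos hi, if_pos hi] at this
  choose a b hab hit him using hT
  have hsub : ∀ n, Icc (a n) (b n) ⊆ Icc l₀ r₀ := fun n x hx => hit n x hx 0 (by omega)
  -- Different exit times separate the intervals: at time `m + 1` the first is in `[l₁, r₁]`, the
  -- second still in `[l₀, r₀]`. Disjointness then forces short lengths.
  have hlt : ∀ m n, m < n → Disjoint (Icc (a m) (b m)) (Icc (a n) (b n)) := by
    intro m n hmn
    rw [Set.disjoint_left]
    intro x hxm hxn
    exact Set.disjoint_left.1 hdisj (hit n x hxn (m + 1) (by omega))
      (him m ▸ mem_image_of_mem _ hxm)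
  have hlen := tendsto_length_of_pairwise_disjoint hsub
    (fun m n hmn => (lt_or_gt_of_ne hmn).elim (hlt m n) fun h => (hlt n m h).symm) hab
  obtain ⟨n, hn, hnN⟩ := ((hlen.eventually (gt_mem_nhds hε)).and (eventually_ge_atTop N)).exists
  exact ⟨n + 1, by omega, a n, b n, hn, hsub n, hit n, him n⟩

/-- A horseshoe carries a family of points, indexed by binary sequences, whose orbits are pairwise
proximal but not asymptotic, and not asymptotic to any periodic sequence. -/
theorem exists_scrambled_of_horseshoe {g : ℝ → ℝ} (hg : Continuous g) {l₀ r₀ l₁ r₁ : ℝ}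
    (h₀ : l₀ ≤ r₀) (h₁ : l₁ ≤ r₁) (hdisj : Disjoint (Icc l₀ r₀) (Icc l₁ r₁))
    (hc₀ : Icc l₀ r₀ ∪ Icc l₁ r₁ ⊆ g '' Icc l₀ r₀)
    (hc₁ : Icc l₀ r₀ ∪ Icc l₁ r₁ ⊆ g '' Icc l₁ r₁) :
    ∃ φ : (ℕ → Bool) → ℝ, (∀ θ, φ θ ∈ Icc l₀ r₀) ∧
      (∃ δ > 0, ∀ θ θ', θ ≠ θ' → ∃ᶠ n in atTop, δ ≤ dist (g^[n] (φ θ)) (g^[n] (φ θ'))) ∧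
      (∀ θ θ', ∀ ε > 0, ∃ᶠ n in atTop, dist (g^[n] (φ θ)) (g^[n] (φ θ')) < ε ∧
        g^[n] (φ θ) ∈ Icc l₀ r₀ ∧ g^[n] (φ θ') ∈ Icc l₀ r₀) ∧
      ∀ θ, ∀ (y : ℕ → ℝ) (q : ℕ), 0 < q → Periodic y q →
        ¬ Tendsto (fun n => dist (g^[n] (φ θ)) (y n)) atTop (𝓝 0) := by
  choose ν hν a b hlen hsub hstay him using fun j : ℕ =>
    exists_short_Icc_of_horseshoe hg h₀ h₁ hdisj hc₀ (Nat.one_div_pos_of_nat (α := ℝ) (n := j)) j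
  -- Block `j` starts at time `M j` in an interval shorter than `1 / (j + 1)`, stays in `[l₀, r₀]`
  -- for `ν j > j` steps, visits `[l₁, r₁]`, and then spends one step in the interval chosen by `θ`.
  -- The digit read is `j.unpair.1`, so every digit is read infinitely often.
  obtain ⟨M, hM⟩ : ∃ M : ℕ → ℕ, M = fun j => ∑ i ∈ Finset.range j, (ν i + 2) := ⟨_, rfl⟩
  have hM0 : M 0 = 0 := by simp [hM]
  have hMs : ∀ j, M (j + 1) = M j + (ν j + 2) := fun j => by rw [hM]; exact Finset.sum_range_succ _ _
  have hMle : ∀ j, j ≤ M j := fun j => by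
    induction j with
    | zero => omega
    | succ j ih => rw [hMs]; omega
  have hMmono : Monotone M := monotone_nat_of_le_succ fun j => by rw [hMs]; omega
  obtain ⟨A, hA⟩ : ∃ A : Bool → Set ℝ, A = fun t => if t then Icc l₁ r₁ else Icc l₀ r₀ := ⟨_, rfl⟩
  have hA0 : A false = Icc l₀ r₀ := by simp [hA]
  have hA1 : A true = Icc l₁ r₁ := by simp [hA]
  have hAc : ∀ t, IsCompact (A t) := fun t => by
    cases t
    · rw [hA0]; exact isCompact_Icc
    · rw [hA1]; exact isCompact_Icc
  have hAcov : ∀ t, Icc l₀ r₀ ⊆ g '' A t := fun t => by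
    cases t
    · rw [hA0]; exact subset_union_left.trans hc₀
    · rw [hA1]; exact subset_union_left.trans hc₁
  have hAsub : ∀ t, A t ⊆ g '' Icc l₁ r₁ := fun t => by
    cases t
    · rw [hA0]; exact subset_union_left.trans hc₁
    · rw [hA1]; exact subset_union_right.trans hc₁
  have hitin : ∀ θ : ℕ → Bool, ∃ x, ∀ j, g^[M j] x ∈ Icc (a j) (b j) ∧
      g^[M j + ν j + 1] x ∈ A (θ j.unpair.1) := by
    intro θ
    have hcov : ∀ j, Icc l₀ r₀ ⊆ g^[ν j + 2] ''
        (Icc (a j) (b j) ∩ g^[ν j + 1] ⁻¹' A (θ j.unpair.1)) := by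
      intro j y hy
      obtain ⟨w, hw, rfl⟩ := hAcov (θ j.unpair.1) hy
      obtain ⟨v, hv, rfl⟩ := hAsub _ hw
      rw [← him j] at hv
      obtain ⟨x, hx, rfl⟩ := hv
      refine ⟨x, ⟨hx, ?_⟩, ?_⟩
      · rw [mem_preimage, iterate_succ_apply']; exact hw
      · rw [iterate_succ_apply', iterate_succ_apply']
    obtain ⟨x, hx⟩ := exists_itinerary_of_isCompact hg
      (C := fun j => Icc (a j) (b j) ∩ g^[ν j + 1] ⁻¹' A (θ j.unpair.1)) hM0 hMmono
      (fun j => isCompact_Icc.inter_right ((hAc _).isClosed.preimage (hg.iterate _)))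
      (fun j => ((nonempty_Icc.2 h₀).mono (hcov j)).of_image)
      (fun j => by
        rw [hMs, Nat.add_sub_cancel_left]
        exact (inter_subset_left.trans (hsub _)).trans (hcov j))
    refine ⟨x, fun j => ⟨(hx j).1, ?_⟩⟩
    have := (hx j).2
    rwa [mem_preimage, ← iterate_add_apply, show ν j + 1 + M j = M j + ν j + 1 by ring] at this
  choose φ hφ hφA using hitin
  have hφ0 : ∀ θ j i, i < ν j → g^[M j + i] (φ θ) ∈ Icc l₀ r₀ := fun θ j i hi => by
    rw [add_comm, iterate_add_apply]
    exact hstay j _ (hφ θ j) i hi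
  have hφ1 : ∀ θ j, g^[M j + ν j] (φ θ) ∈ Icc l₁ r₁ := fun θ j => by
    rw [add_comm, iterate_add_apply, ← him j]
    exact mem_image_of_mem _ (hφ θ j)
  obtain ⟨δ, hδ, hsep⟩ : ∃ δ > 0, ∀ x ∈ Icc l₀ r₀, ∀ y ∈ Icc l₁ r₁, δ ≤ dist x y := by
    rcases lt_or_ge r₀ l₁ with h | h
    · refine ⟨l₁ - r₀, sub_pos.2 h, fun x hx y hy => ?_⟩
      rw [Real.dist_eq, abs_sub_comm]
      exact le_trans (by linarith [hx.2, hy.1]) (le_abs_self _)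
    rcases lt_or_ge r₁ l₀ with h' | h'
    · refine ⟨l₀ - r₁, sub_pos.2 h', fun x hx y hy => ?_⟩
      rw [Real.dist_eq]
      exact le_trans (by linarith [hx.1, hy.2]) (le_abs_self _)
    · exact absurd (show max l₀ l₁ ∈ Icc l₁ r₁ from ⟨le_max_right _ _, max_le h' h₁⟩)
        (Set.disjoint_left.1 hdisj ⟨le_max_left _ _, max_le h₀ h⟩)
  refine ⟨φ, fun θ => ?_, ⟨δ, hδ, fun θ θ' hne => ?_⟩, fun θ θ' ε hε => ?_, fun θ y q hq hy hlim => ?_⟩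
  · have := hφ θ 0
    rw [hM0] at this
    exact hsub 0 this
  · obtain ⟨i, hi⟩ := Function.ne_iff.1 hne
    rw [frequently_atTop]
    intro N
    have h1 := hφA θ (Nat.pair i N)
    have h2 := hφA θ' (Nat.pair i N)
    rw [Nat.unpair_pair] at h1 h2
    refine ⟨M (Nat.pair i N) + ν (Nat.pair i N) + 1, ?_, ?_⟩
    · have := hMle (Nat.pair i N)
      have := Nat.right_le_pair i N
      omega
    · cases hx : θ i <;> cases hy : θ' i <;> simp only [hx, hy] at h1 h2 hi
      · exact absurd rfl hi
      · exact hsep _ (hA0 ▸ h1) _ (hA1 ▸ h2)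
      · rw [dist_comm]
        exact hsep _ (hA0 ▸ h2) _ (hA1 ▸ h1)
      · exact absurd rfl hi
  · rw [frequently_atTop]
    intro N
    obtain ⟨k, hk⟩ := exists_nat_one_div_lt hε
    have h1 := hφ θ (max N k)
    have h2 := hφ θ' (max N k)
    refine ⟨M (max N k), (le_max_left N k).trans (hMle _), ?_, hsub _ h1, hsub _ h2⟩
    refine (Real.dist_le_of_mem_Icc h1 h2).trans_lt ((hlen _).trans (lt_of_le_of_lt ?_ hk))
    exact Nat.one_div_le_one_div (le_max_right N k)
  · obtain ⟨N, hN⟩ := eventually_atTop.1 (hlim.eventually (gt_mem_nhds (half_pos hδ)))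
    obtain ⟨n₁, hn₁⟩ : ∃ n, n = M N + ν N := ⟨_, rfl⟩
    have hn₁N : N ≤ n₁ := by have := hMle N; omega
    obtain ⟨j, hj⟩ : ∃ j, j = max N q := ⟨_, rfl⟩
    have hi : (n₁ + (q - 1) * M j) % q < q := Nat.mod_lt _ hq
    -- A stay longer than `q` contains a time `n₂` congruent to `n₁` modulo `q`; the added `(q - 1)
    -- * M j` replaces `- M j`. Then `y n₂ = y n₁` would be within `δ / 2` of points of both
    -- intervals.
    obtain ⟨n₂, hn₂⟩ : ∃ n, n = M j + (n₁ + (q - 1) * M j) % q := ⟨_, rfl⟩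
    have hn₂N : N ≤ n₂ := by
      have := hMle j
      have := le_max_left N q
      omega
    have hx₂ : g^[n₂] (φ θ) ∈ Icc l₀ r₀ := by
      rw [hn₂]
      refine hφ0 θ j _ (hi.trans ?_)
      have := le_max_right N q
      have := hν j
      omega
    have hyy : y n₂ = y n₁ := by
      rw [← hy.map_mod_nat n₂, ← hy.map_mod_nat n₁]
      congr 1
      rw [hn₂, Nat.add_mod_mod, show M j + (n₁ + (q - 1) * M j) = n₁ + q * M j by
        obtain ⟨q, rfl⟩ : ∃ k, q = k + 1 := ⟨q - 1, by omega⟩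
        rw [Nat.add_sub_cancel]; ring, Nat.add_mul_mod_self_left]
    have h1 := hN n₁ hn₁N
    have h2 := hN n₂ hn₂N
    have h3 := hsep _ hx₂ _ (hn₁ ▸ hφ1 θ N)
    rw [hyy] at h2
    rw [dist_comm] at h1
    linarith [dist_triangle (g^[n₂] (φ θ)) (y n₁) (g^[n₁] (φ θ))]

/-- A three-cycle of a self-map of the line, labelled along the map with the median second. -/
theorem exists_three_cycle {f : ℝ → ℝ} {s : ℝ} (hs : minimalPeriod f s = 3) {U : Set ℝ}
    (hsU : ∀ k, f^[k] s ∈ U) :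
    ∃ a b c, a ∈ U ∧ c ∈ U ∧ f a = b ∧ f b = c ∧ f c = a ∧ a ≠ b ∧ b ≠ c ∧ b ∈ uIcc a c := by
  have hinj : ∀ i < 3, ∀ j < 3, i ≠ j → f^[i] s ≠ f^[j] s := fun i hi j hj hij h =>
    hij ((iterate_eq_iterate_iff_of_lt_minimalPeriod (by omega) (by omega)).1 h)
  have h01 : s ≠ f s := hinj 0 (by omega) 1 (by omega) (by omega)
  have h02 : s ≠ f (f s) := hinj 0 (by omega) 2 (by omega) (by omega)
  have h12 : f s ≠ f (f s) := hinj 1 (by omega) 2 (by omega) (by omega)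
  have h3 : f (f (f s)) = s := by
    have := iterate_minimalPeriod (f := f) (x := s)
    rwa [hs] at this
  have m0 : s ∈ U := hsU 0
  have m1 : f s ∈ U := hsU 1
  have m2 : f (f s) ∈ U := hsU 2
  by_cases hb1 : f s ∈ uIcc s (f (f s))
  · exact ⟨s, f s, f (f s), m0, m2, rfl, rfl, h3, h01, h12, hb1⟩
  by_cases hb2 : f (f s) ∈ uIcc (f s) s
  · exact ⟨f s, f (f s), s, m1, m0, rfl, h3, rfl, h12, h02.symm, hb2⟩
  · refine ⟨f (f s), s, f s, m2, m1, h3, rfl, rfl, h02.symm, h01, ?_⟩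
    rw [mem_uIcc] at *
    grind

/-- Period three implies all periods. -/
theorem exists_minimalPeriod_eq_of_three {f : ℝ → ℝ} (hf : Continuous f) {s : ℝ}
    (hs : minimalPeriod f s = 3) {U : Set ℝ} (hU : U.OrdConnected) (hsU : ∀ k, f^[k] s ∈ U)
    {m : ℕ} (hm : 0 < m) : ∃ x ∈ U, minimalPeriod f x = m := by
  rcases Nat.lt_or_ge m 2 with h | h
  · obtain rfl : m = 1 := by omega
    obtain ⟨a, b, c, ha, hc, hab, hbc, hca, -, -, hb⟩ := exists_three_cycle hs hsU
    have h0 : (0 : ℝ) ∈ uIcc (f b - b) (f c - c) := by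
      rw [hbc, hca]
      rw [mem_uIcc] at hb ⊢
      grind
    obtain ⟨x, hx, hfx⟩ := intermediate_value_uIcc (hf.sub continuous_id).continuousOn h0
    refine ⟨x, hU.uIcc_subset ha hc (uIcc_subset_uIcc_right hb hx), ?_⟩
    exact minimalPeriod_eq_one_iff_isFixedPt.2 (sub_eq_zero.1 hfx)
  -- For `n = 3` the bound `2 * n - 4` equals `2`.
  · exact exists_minimalPeriod_eq_of_odd hf hs (by decide) le_rfl (by omega) hU hsU

/-- If the second iterate has a three-cycle, then the map has cycles of all even lengths. -/
theorem exists_minimalPeriod_eq_two_mul {F : ℝ → ℝ} (hF : Continuous F) {s : ℝ}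
    (hs : minimalPeriod F^[2] s = 3) {U : Set ℝ} (hU : U.OrdConnected) (hFU : MapsTo F U U)
    (hsU : s ∈ U) {n : ℕ} (hn : 0 < n) : ∃ x ∈ U, minimalPeriod F x = 2 * n := by
  -- Squaring halves even periods and preserves odd ones.
  have hgcd : ∀ x m, minimalPeriod F^[2] x = m → 0 < m →
      minimalPeriod F x = 2 * m ∨ (Odd m ∧ minimalPeriod F x = m) := by
    intro x m hx hm
    rw [minimalPeriod_iterate_eq_div_gcd two_ne_zero] at hx
    rcases Nat.even_or_odd (minimalPeriod F x) with he | ho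
    · rw [Nat.gcd_eq_right he.two_dvd] at hx
      have := Nat.div_mul_cancel he.two_dvd
      left; omega
    · rw [Nat.Coprime.gcd_eq_one (Nat.coprime_two_right.2 ho), Nat.div_one] at hx
      exact Or.inr ⟨hx ▸ ho, hx⟩
  have h2 : ∀ m, 0 < m → ∃ x ∈ U, minimalPeriod F^[2] x = m := fun m hm =>
    exists_minimalPeriod_eq_of_three (hF.iterate 2) hs hU
      (fun k => (hFU.iterate 2).iterate k hsU) hm
  by_cases h1 : n = 1
  · obtain ⟨x, hxU, hx⟩ := h2 2 two_pos
    rcases hgcd x 2 hx two_pos with h | ⟨h, -⟩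
    · subst h1
      exact exists_minimalPeriod_eq_two_of_four hF h hU fun k => hFU.iterate k hxU
    · exact absurd h (by decide)
  · obtain ⟨x, hxU, hx⟩ := h2 n hn
    rcases hgcd x n hx hn with h | ⟨ho, h⟩
    · exact ⟨x, hxU, h⟩
    · have : 3 ≤ n := by
        obtain ⟨k, rfl⟩ := ho
        omega
      exact exists_minimalPeriod_eq_of_odd hF h ho this (by omega) hU fun k => hFU.iterate k hxU

end IntervalDynamics

namespace RickerEq

variable {a : ℕ → ℝ} {t₀ : ℝ} {p q r : ℕ}

theorem HasMinimalPeriod.dvd {u : ℕ → ℝ} (h : HasMinimalPeriod u q) (hr : Periodic u r) :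
    q ∣ r := by
  obtain ⟨⟨hq, hper⟩, hmin⟩ := h
  by_contra hdvd
  have hmod : Periodic u (r % q) := fun n => by
    have h1 := (hper.nat_mul (r / q)) (n + r % q)
    rw [← h1, ← hr n]
    congr 1
    have := Nat.mod_add_div r q
    rw [mul_comm] at this
    simp only [Nat.cast_id]
    omega
  have hpos : 0 < r % q := Nat.pos_of_ne_zero fun h => hdvd (Nat.dvd_of_mod_eq_zero h)
  have : q ≤ r % q := hmin ⟨hpos, hmod⟩
  exact absurd (Nat.mod_lt r hq) (not_lt.2 this)

/-! ### The coefficients `t_n` and their periods. -/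

theorem tSeq_zero (a : ℕ → ℝ) (t₀ : ℝ) : tSeq a t₀ 0 = t₀ := by
  simp [tSeq, altSum]

theorem tSeq_pos (ht₀ : 0 < t₀) (n : ℕ) : 0 < tSeq a t₀ n :=
  mul_pos (zpow_pos ht₀ _) (Real.exp_pos _)

theorem tSeq_succ_mul (ht₀ : 0 < t₀) (n : ℕ) :
    tSeq a t₀ (n + 1) * tSeq a t₀ n = Real.exp (a n) := by
  have h1 : t₀ ^ ((-1 : ℤ) ^ (n + 1)) * t₀ ^ ((-1 : ℤ) ^ n) = 1 := by
    rw [← zpow_add₀ ht₀.ne', pow_succ]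
    simp
  have h2 : (-1 : ℝ) ^ n * (-1 : ℝ) ^ n = 1 := by
    rw [← mul_pow]; simp
  calc tSeq a t₀ (n + 1) * tSeq a t₀ n
      = (t₀ ^ ((-1 : ℤ) ^ (n + 1)) * t₀ ^ ((-1 : ℤ) ^ n)) *
        Real.exp ((-1 : ℝ) ^ (n + 1) * altSum a (n + 1) + (-1 : ℝ) ^ n * altSum a n) := by
        rw [Real.exp_add]; unfold tSeq; ring
    _ = Real.exp (a n) := by
        rw [h1, one_mul]
        congr 1
        rw [altSum, Finset.sum_range_succ, ← altSum, pow_succ]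
        linear_combination a n * h2

/-- The recursion `t_{n+1} t_n = e^{a_n}` determines `t` from `t₀`, so a single return to `t₀` after
a period of `a` suffices. -/
theorem tSeq_periodic (ht₀ : 0 < t₀) (ha : Periodic a q) (h : tSeq a t₀ q = t₀) :
    Periodic (tSeq a t₀) q := by
  intro n
  induction n with
  | zero => rw [Nat.zero_add, h, tSeq_zero]
  | succ n ih =>
    have h1 := tSeq_succ_mul (a := a) ht₀ (n + q)
    rw [ha n, ih, ← tSeq_succ_mul ht₀ n, show n + q + 1 = n + 1 + q by ring] at h1
    exact mul_right_cancel₀ (tSeq_pos ht₀ n).ne' h1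

theorem periodic_of_tSeq_periodic (ht₀ : 0 < t₀) (h : Periodic (tSeq a t₀) r) : Periodic a r := by
  intro n
  have h1 := tSeq_succ_mul (a := a) ht₀ (n + r)
  rw [h n, show n + r + 1 = n + 1 + r by ring, h (n + 1), tSeq_succ_mul ht₀ n] at h1
  exact (Real.exp_injective h1).symm

theorem tSeq_of_odd (hp : Odd p) : tSeq a t₀ p = t₀⁻¹ * Real.exp (-altSum a p) := by
  simp [tSeq, hp.neg_one_pow]

theorem tSeq_odd_eq_iff (ht₀ : 0 < t₀) (hp : Odd p) :
    tSeq a t₀ p = t₀ ↔ t₀ = Real.exp (-altSum a p / 2) := by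
  rw [tSeq_of_odd hp, inv_mul_eq_iff_eq_mul₀ ht₀.ne',
    show -altSum a p = -altSum a p / 2 + -altSum a p / 2 by ring, Real.exp_add,
    mul_self_inj_of_nonneg (Real.exp_pos _).le ht₀.le]
  constructor
  · intro h
    rw [← h]
    ring_nf
  · intro h
    conv_rhs => rw [h]
    ring_nf

/-- A shift by the odd number `p` reverses the signs, so the two halves cancel. -/
theorem altSum_two_mul (hp : Odd p) (ha : Periodic a p) : altSum a (2 * p) = 0 := by
  rw [two_mul, altSum, Finset.sum_range_add, ← Finset.sum_add_distrib]
  refine Finset.sum_eq_zero fun i _ => ?_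
  rw [add_comm p i, ha i, show i + p + 1 = (i + 1) + p by ring, pow_add _ (i + 1), hp.neg_one_pow]
  ring

theorem tSeq_two_mul_periodic (ht₀ : 0 < t₀) (hp : Odd p) (ha : Periodic a p) :
    Periodic (tSeq a t₀) (2 * p) := by
  refine tSeq_periodic ht₀ (by simpa using ha.nat_mul 2) ?_
  simp [tSeq, altSum_two_mul hp ha]

/-- A period of `t` is a period of `a`, hence a multiple of `p`; an odd multiple would, modulo `2 *
p`, give `t_p = t₀`, the excluded case. -/
theorem two_mul_dvd_of_tSeq_periodic (ht₀ : 0 < t₀) (hp : Odd p) (ha : HasMinimalPeriod a p)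
    (hne : t₀ ≠ Real.exp (-altSum a p / 2)) (h : Periodic (tSeq a t₀) r) : 2 * p ∣ r := by
  obtain ⟨m, rfl⟩ := ha.dvd (periodic_of_tSeq_periodic ht₀ h)
  rcases Nat.even_or_odd' m with ⟨k, rfl | rfl⟩
  · exact ⟨k, by ring⟩
  · refine absurd ((tSeq_odd_eq_iff ht₀ hp).1 ?_) hne
    have h1 := ((tSeq_two_mul_periodic ht₀ hp ha.1.2).nat_mul k) p
    have h2 := h 0
    simp only [Nat.cast_id] at h1
    rw [Nat.zero_add, tSeq_zero, show p * (2 * k + 1) = p + k * (2 * p) by ring, h1] at h2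
    exact h2

/-! ### Solutions as orbits of the composed maps. -/

theorem gMap_pos (ht₀ : 0 < t₀) (k : ℕ) {x : ℝ} (hx : 0 < x) : 0 < gMap a t₀ k x :=
  mul_pos (mul_pos (tSeq_pos ht₀ k) hx) (Real.exp_pos _)

theorem continuous_gMap (a : ℕ → ℝ) (t₀ : ℝ) (k : ℕ) : Continuous (gMap a t₀ k) := by
  unfold gMap
  fun_prop

theorem fMap_succ_apply (a : ℕ → ℝ) (t₀ : ℝ) (k : ℕ) (x : ℝ) :
    fMap a t₀ (k + 1) x = gMap a t₀ k (fMap a t₀ k x) := rfl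

theorem fMap_pos (ht₀ : 0 < t₀) (k : ℕ) {x : ℝ} (hx : 0 < x) : 0 < fMap a t₀ k x := by
  induction k with
  | zero => exact hx
  | succ k ih => exact gMap_pos ht₀ k ih

theorem mapsTo_fMap (ht₀ : 0 < t₀) (k : ℕ) : MapsTo (fMap a t₀ k) (Ioi 0) (Ioi 0) :=
  fun _ hx => fMap_pos ht₀ k hx

theorem continuous_fMap (a : ℕ → ℝ) (t₀ : ℝ) (k : ℕ) : Continuous (fMap a t₀ k) := by
  induction k with
  | zero => exact continuous_id
  | succ k ih => exact (continuous_gMap a t₀ k).comp ih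

theorem gMap_add (ht : Periodic (tSeq a t₀) q) (k : ℕ) : gMap a t₀ (k + q) = gMap a t₀ k := by
  ext x
  rw [gMap, ht k, gMap]

theorem fMap_add (ht : Periodic (tSeq a t₀) q) (n : ℕ) (x : ℝ) :
    fMap a t₀ (n + q) x = fMap a t₀ n (fMap a t₀ q x) := by
  induction n with
  | zero => rw [Nat.zero_add]; rfl
  | succ n ih => rw [Nat.add_right_comm, fMap_succ_apply, ih, gMap_add ht, fMap_succ_apply]

theorem fMap_mul (ht : Periodic (tSeq a t₀) q) (m : ℕ) :
    fMap a t₀ (q * m) = (fMap a t₀ q)^[m] := by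
  induction m with
  | zero => rfl
  | succ m ih => ext x; rw [mul_add, mul_one, fMap_add ht, ih, iterate_succ_apply]

/-- On the curve `v = g₀(u)` the solution of the equation is given by the maps `g_k`. -/
theorem solution_eq_fMap (a : ℕ → ℝ) (ht₀ : 0 < t₀) (s : ℝ) :
    solution a s (t₀ * s * Real.exp (-s)) = fun n => fMap a t₀ n s := by
  have h : ∀ n, solution a s (t₀ * s * Real.exp (-s)) n = fMap a t₀ n s ∧
      solution a s (t₀ * s * Real.exp (-s)) (n + 1) = fMap a t₀ (n + 1) s := by
    intro n
    induction n with
    | zero =>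
      refine ⟨rfl, ?_⟩
      change t₀ * s * Real.exp (-s) = gMap a t₀ 0 s
      rw [gMap, tSeq_zero]
    | succ n ih =>
      refine ⟨ih.2, ?_⟩
      rw [solution, ih.1, ih.2, fMap_succ_apply a t₀ (n + 1), gMap,
        show a n - fMap a t₀ n s - fMap a t₀ (n + 1) s =
          a n + -fMap a t₀ n s + -fMap a t₀ (n + 1) s by ring, Real.exp_add, Real.exp_add,
        ← tSeq_succ_mul ht₀ n]
      have h1 : fMap a t₀ (n + 1) s = tSeq a t₀ n * fMap a t₀ n s * Real.exp (-fMap a t₀ n s) := rfl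
      linear_combination (-tSeq a t₀ (n + 1) * Real.exp (-fMap a t₀ (n + 1) s)) * h1
  exact funext fun n => (h n).1

/-- Two consecutive positive terms of the orbit determine `t_n`, so the orbit cannot have a period
that `t` lacks. -/
theorem tSeq_periodic_of_fMap_periodic (ht₀ : 0 < t₀) {s : ℝ} (hs : 0 < s)
    (h : Periodic (fun n => fMap a t₀ n s) r) : Periodic (tSeq a t₀) r := by
  intro n
  have h1 := h n
  have h2 := h (n + 1)
  simp only [show n + 1 + r = n + r + 1 by ring, fMap_succ_apply] at h1 h2
  rw [h1, gMap, gMap] at h2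
  exact mul_right_cancel₀ (fMap_pos ht₀ n hs).ne' (mul_right_cancel₀ (Real.exp_pos _).ne' h2)

theorem fMap_periodic_of_isPeriodicPt (ht : Periodic (tSeq a t₀) q) {s : ℝ} {ω : ℕ}
    (hs : IsPeriodicPt (fMap a t₀ q) ω s) : Periodic (fun n => fMap a t₀ n s) (q * ω) := by
  intro n
  have hq : Periodic (tSeq a t₀) (q * ω) := by
    rw [mul_comm]; simpa using ht.nat_mul ω
  simp only
  rw [fMap_add hq, fMap_mul ht, hs.eq]

theorem hasMinimalPeriod_fMap (ht₀ : 0 < t₀) (hq : 0 < q) (ht : Periodic (tSeq a t₀) q)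
    (hdvd : ∀ r, Periodic (tSeq a t₀) r → q ∣ r) {s : ℝ} (hs : 0 < s) {ω : ℕ} (hω : 0 < ω)
    (hmin : minimalPeriod (fMap a t₀ q) s = ω) :
    HasMinimalPeriod (fun n => fMap a t₀ n s) (q * ω) := by
  refine ⟨⟨Nat.mul_pos hq hω, fMap_periodic_of_isPeriodicPt ht (hmin ▸ isPeriodicPt_minimalPeriod _ _)⟩, ?_⟩
  rintro r ⟨hr, hper⟩
  obtain ⟨m, rfl⟩ := hdvd r (tSeq_periodic_of_fMap_periodic ht₀ hs hper)
  have hm : IsPeriodicPt (fMap a t₀ q) m s := by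
    have := hper 0
    rw [Nat.zero_add] at this
    simp only [fMap_mul ht] at this
    exact this
  rw [← hmin]
  exact Nat.mul_le_mul_left q (hm.minimalPeriod_le (Nat.pos_of_mul_pos_left hr))

/-! ### Transfer of chaos to the state plane, and the theorem. -/

/-- If the composition `f` over a double period has a three-cycle, then there are Li–Yorke chaotic
solutions with initial values on the curve `v = g₀(u)`. -/
theorem exists_isLiYorkeChaoticSet (ht₀ : 0 < t₀) (hq : 0 < q) (ht : Periodic (tSeq a t₀) q)
    {s : ℝ} (hs : 0 < s) (h3 : minimalPeriod (fMap a t₀ q) s = 3) :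
    ∃ S : Set (ℝ × ℝ), (∀ z ∈ S, z.2 = t₀ * z.1 * Real.exp (-z.1)) ∧ IsLiYorkeChaoticSet a S := by
  obtain ⟨x, y, w, hx, hw, hxy, hyw, hwx, hne, -, hy⟩ :=
    IntervalDynamics.exists_three_cycle h3 (fun k => (mapsTo_fMap ht₀ q).iterate k hs)
  obtain ⟨l₀, r₀, l₁, r₁, h₀, h₁, hdisj, hs₀, hs₁, hc₀, hc₁⟩ :=
    IntervalDynamics.exists_horseshoe_of_three_cycle (continuous_fMap a t₀ q) hxy hyw hwx hne hy
  have hl₀ : ∀ x ∈ Icc l₀ r₀, 0 < x := fun x hx' =>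
    ordConnected_Ioi.uIcc_subset hx hw (hs₀ hx')
  -- The horseshoe belongs to `f^[4]`, so states are compared at multiples of `4 * q`, where the
  -- second coordinate is `g_0` of the first.
  obtain ⟨K, hK⟩ : ∃ K, K = q * 4 := ⟨_, rfl⟩
  have hKpos : 0 < K := by omega
  have htK : Periodic (tSeq a t₀) K := by
    rw [hK, mul_comm]; simpa using ht.nat_mul 4
  rw [← fMap_mul ht 4, ← hK] at hc₀ hc₁
  obtain ⟨φ, hφ, ⟨δ, hδ, hsep⟩, hprox, hper⟩ :=
    IntervalDynamics.exists_scrambled_of_horseshoe (continuous_fMap a t₀ K) h₀ h₁ hdisj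
      ((union_subset hs₀ hs₁).trans hc₀) ((union_subset hs₀ hs₁).trans hc₁)
  have hlim : Tendsto (fun n => K * n) atTop atTop := tendsto_id.const_mul_atTop' hKpos
  obtain ⟨ψ, hψ⟩ : ∃ ψ : (ℕ → Bool) → ℝ × ℝ,
      ψ = fun θ => (φ θ, t₀ * φ θ * Real.exp (-φ θ)) := ⟨_, rfl⟩
  have hfst : ∀ θ n, (state a (ψ θ) (K * n)).1 = (fMap a t₀ K)^[n] (φ θ) := fun θ n => by
    simp only [state, hψ, solution_eq_fMap a ht₀, fMap_mul htK]
  have hsnd : ∀ θ n, (state a (ψ θ) (K * n)).2 = gMap a t₀ 0 ((fMap a t₀ K)^[n] (φ θ)) :=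
    fun θ n => by
    have hKn : Periodic (tSeq a t₀) (K * n) := by
      rw [mul_comm]; simpa using htK.nat_mul n
    simp only [state, hψ, solution_eq_fMap a ht₀, fMap_succ_apply]
    rw [← fMap_mul htK, ← gMap_add hKn 0, Nat.zero_add]
  have hinj : Injective φ := fun θ θ' h => by
    by_contra hθ
    obtain ⟨n, hn⟩ := (hsep θ θ' hθ).exists
    rw [h, dist_self] at hn
    linarith
  refine ⟨range ψ, ?_, ⟨?_, ?_, ?_, ?_, ?_⟩⟩
  · rintro _ ⟨θ, rfl⟩
    rw [hψ]
  · rintro _ ⟨θ, rfl⟩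
    have := hl₀ _ (hφ θ)
    rw [hψ]
    exact ⟨this, mul_pos (mul_pos ht₀ this) (Real.exp_pos _)⟩
  · intro hcount
    have hψinj : Injective ψ := fun θ θ' h => hinj (by rw [hψ] at h; exact congrArg Prod.fst h)
    rw [← image_univ] at hcount
    have := countable_of_injective_of_countable_image hψinj.injOn hcount
    have hunc : Uncountable (ℕ → Bool) := by
      rw [← Cardinal.aleph0_lt_mk_iff]
      simpa using Cardinal.cantor Cardinal.aleph0
    exact not_countable_univ this
  · rintro _ ⟨θ, rfl⟩ _ ⟨θ', rfl⟩ hne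
    refine lt_of_lt_of_le (ENNReal.ofReal_pos.2 hδ) (le_limsup_of_frequently_le ?_)
    refine hlim.frequently ((hsep θ θ' fun h => hne (h ▸ rfl)).mono fun n hn => ?_)
    rw [Prod.edist_eq, hfst, hfst, edist_dist]
    exact le_max_of_le_left (ENNReal.ofReal_le_ofReal hn)
  · rintro _ ⟨θ, rfl⟩ _ ⟨θ', rfl⟩ -
    by_contra hpos
    obtain ⟨c, hc0, hc⟩ := exists_between (pos_iff_ne_zero.2 hpos)
    have hctop : c ≠ ⊤ := hc.ne_top
    have hcr : 0 < c.toReal := ENNReal.toReal_pos hc0.ne' hctop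
    -- Uniform continuity of `g_0` on `[l₀, r₀]` makes the second coordinates close as well; this is
    -- why proximality was recorded at times when both points are in that interval.
    obtain ⟨η, hη, hunif⟩ := Metric.uniformContinuousOn_iff.1
      ((isCompact_Icc (a := l₀) (b := r₀)).uniformContinuousOn_of_continuous
        (continuous_gMap a t₀ 0).continuousOn) c.toReal hcr
    suffices hfreq : ∃ᶠ n in atTop, ¬ c < edist (state a (ψ θ) n) (state a (ψ θ') n) by
      exact hfreq ((eventually_lt_of_lt_liminf hc).mono fun n hn => not_not.2 hn)
    refine hlim.frequently ((hprox θ θ' (min η c.toReal) (lt_min hη hcr)).mono fun n hn => ?_)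
    obtain ⟨hd, hm, hm'⟩ := hn
    rw [not_lt, Prod.edist_eq, hfst, hfst, hsnd, hsnd, edist_dist, edist_dist]
    refine max_le ?_ ?_
    · exact ENNReal.ofReal_le_of_le_toReal (hd.le.trans (min_le_right _ _))
    · exact ENNReal.ofReal_le_of_le_toReal
        (hunif _ hm _ hm' (hd.trans_le (min_le_left _ _))).le
  · rintro _ ⟨θ, rfl⟩ w - - ⟨r, hr, hwper⟩
    by_contra hpos
    have hzero := tendsto_of_le_liminf_of_limsup_le zero_le (not_lt.1 hpos)
    refine hper θ (fun n => solution a w.1 w.2 (K * n)) r hr (fun n => ?_) ?_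
    · have := hwper.nat_mul K (K * n)
      simp only [Nat.cast_id] at this
      simp only
      rw [mul_add, this]
    · have h1 := hzero.comp hlim
      have h2 := tendsto_of_tendsto_of_tendsto_of_le_of_le tendsto_const_nhds h1
        (fun _ => zero_le) (fun n => le_max_left
          (edist (state a (ψ θ) (K * n)).1 (state a w (K * n)).1) _)
      have h3 := (ENNReal.tendsto_toReal ENNReal.zero_ne_top).comp h2
      refine h3.congr fun n => ?_
      rw [comp_apply, hfst, edist_dist, ENNReal.toReal_ofReal dist_nonneg]
      rfl

end RickerEq

theorem theorem3p9 (a : ℕ → ℝ) (p : ℕ) (hp : Odd p) (ha : HasMinimalPeriod a p)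
    (t₀ : ℝ) (ht₀ : 0 < t₀) :
    -- (a)
    (∀ (s : ℝ) (ω : ℕ), 0 < s → 0 < ω → Function.IsPeriodicPt (fMap a t₀ (2 * p)) ω s →
      Function.Periodic (solution a s (t₀ * s * Real.exp (-s))) (2 * p * ω) ∧
      (t₀ ≠ Real.exp (-altSum a p / 2) →
        Function.minimalPeriod (fMap a t₀ (2 * p)) s = ω →
        HasMinimalPeriod (solution a s (t₀ * s * Real.exp (-s))) (2 * p * ω))) ∧
    -- (b)
    (t₀ = Real.exp (-altSum a p / 2) →
      (∀ (s : ℝ) (ω : ℕ), 0 < s → 0 < ω → Function.IsPeriodicPt (fMap a t₀ p) ω s →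
        Function.Periodic (solution a s (s * Real.exp (-altSum a p / 2 - s))) (p * ω) ∧
        (Function.minimalPeriod (fMap a t₀ p) s = ω →
          HasMinimalPeriod (solution a s (s * Real.exp (-altSum a p / 2 - s))) (p * ω))) ∧
      (∀ z : ℝ × ℝ, 0 < z.1 → z.2 = gMap a t₀ 0 z.1 →
        ∀ m : ℕ, 0 < (state a z (p * m)).1 ∧
          (state a z (p * m)).2 = gMap a t₀ 0 (state a z (p * m)).1)) ∧
    -- (c)
    (∀ s : ℝ, 0 < s → s ∉ Function.periodicPts (fMap a t₀ (2 * p)) →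
      ¬ IsPeriodicSeq (solution a s (t₀ * s * Real.exp (-s)))) ∧
    -- (d)
    ((∃ s : ℝ, 0 < s ∧ Function.minimalPeriod (fMap a t₀ (2 * p)) s = 3) →
      (∀ n : ℕ, 0 < n → ∃ s : ℝ, 0 < s ∧
        HasMinimalPeriod (solution a s (t₀ * s * Real.exp (-s))) (2 * p * n)) ∧
      ∃ S : Set (ℝ × ℝ), (∀ z ∈ S, z.2 = t₀ * z.1 * Real.exp (-z.1)) ∧
        IsLiYorkeChaoticSet a S) := by
  have hp0 : 0 < p := ha.1.1
  have ht2 : Periodic (tSeq a t₀) (2 * p) := tSeq_two_mul_periodic ht₀ hp ha.1.2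
  have hpart_a : t₀ ≠ Real.exp (-altSum a p / 2) → ∀ (s : ℝ) (ω : ℕ), 0 < s → 0 < ω →
      minimalPeriod (fMap a t₀ (2 * p)) s = ω →
      HasMinimalPeriod (solution a s (t₀ * s * Real.exp (-s))) (2 * p * ω) := by
    intro hne s ω hs hω hmin
    rw [solution_eq_fMap a ht₀]
    exact hasMinimalPeriod_fMap ht₀ (by omega) ht2
      (fun r => two_mul_dvd_of_tSeq_periodic ht₀ hp ha hne) hs hω hmin
  have ht1 : t₀ = Real.exp (-altSum a p / 2) → Periodic (tSeq a t₀) p := fun heq =>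
    tSeq_periodic ht₀ ha.1.2 ((tSeq_odd_eq_iff ht₀ hp).2 heq)
  have hpart_b : t₀ = Real.exp (-altSum a p / 2) → ∀ (s : ℝ) (ω : ℕ), 0 < s → 0 < ω →
      minimalPeriod (fMap a t₀ p) s = ω →
      HasMinimalPeriod (solution a s (t₀ * s * Real.exp (-s))) (p * ω) := by
    intro heq s ω hs hω hmin
    rw [solution_eq_fMap a ht₀]
    exact hasMinimalPeriod_fMap ht₀ hp0 (ht1 heq)
      (fun r hr => ha.dvd (periodic_of_tSeq_periodic ht₀ hr)) hs hω hmin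
  refine ⟨fun s ω hs hω hper => ⟨?_, fun hne => hpart_a hne s ω hs hω⟩, fun heq => ⟨?_, ?_⟩, ?_, ?_⟩
  · rw [solution_eq_fMap a ht₀]
    exact fMap_periodic_of_isPeriodicPt ht2 hper
  · intro s ω hs hω hper
    have hv : s * Real.exp (-altSum a p / 2 - s) = t₀ * s * Real.exp (-s) := by
      rw [sub_eq_add_neg, Real.exp_add, ← heq]
      ring
    rw [hv]
    refine ⟨?_, hpart_b heq s ω hs hω⟩
    rw [solution_eq_fMap a ht₀]
    exact fMap_periodic_of_isPeriodicPt (ht1 heq) hper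
  · intro z hz hzg m
    have hpm : Periodic (tSeq a t₀) (p * m) := by
      rw [mul_comm]; simpa using (ht1 heq).nat_mul m
    rw [gMap, tSeq_zero] at hzg
    simp only [state, hzg, solution_eq_fMap a ht₀]
    refine ⟨fMap_pos ht₀ _ hz, ?_⟩
    rw [fMap_succ_apply, ← gMap_add hpm 0, Nat.zero_add]
  · rintro s hs hnper ⟨r, hr, hper⟩
    rw [solution_eq_fMap a ht₀] at hper
    refine hnper ⟨r, hr, ?_⟩
    -- A period `r` of the solution makes `2 * p * r` a period, which is `r` steps of `f`.
    have h1 := hper.nat_mul (2 * p) 0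
    simp only [Nat.cast_id, Nat.zero_add, fMap_mul ht2] at h1
    exact h1
  · rintro ⟨s, hs, h3⟩
    refine ⟨fun n hn => ?_, exists_isLiYorkeChaoticSet ht₀ (by omega) ht2 hs h3⟩
    -- In the exceptional case an `n`-cycle of `f` may only give period `p * n`, so a `2 * n`-cycle
    -- of `F` is used instead.
    by_cases heq : t₀ = Real.exp (-altSum a p / 2)
    · rw [mul_comm 2 p, fMap_mul (ht1 heq)] at h3
      obtain ⟨x, hx, hmin⟩ := IntervalDynamics.exists_minimalPeriod_eq_two_mul
        (continuous_fMap a t₀ p) h3 ordConnected_Ioi (mapsTo_fMap ht₀ p) hs hn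
      refine ⟨x, hx, ?_⟩
      rw [show 2 * p * n = p * (2 * n) by ring]
      exact hpart_b heq x (2 * n) hx (by omega) hmin
    · obtain ⟨x, hx, hmin⟩ := IntervalDynamics.exists_minimalPeriod_eq_of_three
        (continuous_fMap a t₀ (2 * p)) h3 ordConnected_Ioi
        (fun k => (mapsTo_fMap ht₀ (2 * p)).iterate k hs) hn
      exact ⟨x, hx, hpart_a heq x n hx hn hmin⟩
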